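/- **Setting.** For a two-qubit state $\rho$ shared by Alice (first qubit) and Bob (second qubit) let $t_{ij}=\mathrm{Tr}(\rho\,\sigma_i\otimes\sigma_j)$ be its correlation matrix and let $\delta_1\ge\delta_2$ be the two largest eigenvalues (with multiplicity) of $R=\sqrt{t^\dagger t}$. Choose orthonormal vectors $\vec e,\vec f\in\mathbb R^3$ with $tt^{T}\vec e=\delta_1^2\vec e$ and $tt^{T}\vec f=\delta_2^2\vec f$ (such vectors always exist; in local bases in which $t$ is diagonal with $|t_{zz}|=\delta_1$, $|t_{xx}|=\delta_2$ one may take the $z$- and the $x$-axis, so that $\sigma_{\vec e}=\sigma_z$, $\sigma_{\vec f}=\sigma_x$). For $\theta\in(0,\frac{\pi}{4}]$ and sharpness parameters $\gamma_1,\gamma_2,\dots\in(0,1)$ the $k$-th Alice has the POVMs $$A^{k}_{0|x}=\tfrac12\bigl(I_2+\cos\theta\,\sigma_{\vec e}+(-1)^x\gamma_k\sin\theta\,\sigma_{\vec f}\bigr),\qquad A^{k}_{1|x}=I_2-A^{k}_{0|x},\qquad x\in\{0,1\}.$$ Put $\rho^{(1)}=\rho$ and $$\rho^{(k+1)}=\tfrac12\sum_{a,x\in\{0,1\}}\bigl(\sqrt{A^{k}_{a|x}}\otimes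 I_2\bigr)\rho^{(k)}\bigl(\sqrt{A^{k}_{a|x}}\otimes I_2\bigr),$$ so that $\rho^{(k)}$ is the state shared by the $k$-th Alice (after $k-1$ consecutive measurements) and Bob. In the $n$-partite star network, source $i$ distributes a two-qubit state $\rho_{A_iB}$ to the node $A_i$ and the central node $B$. The network state $\rho_{A_1B}\otimes\cdots\otimes\rho_{A_nB}$ *has network nonlocality* if there are two two-outcome POVMs for each node $A_i$ and two two-outcome POVMs on the $n$ qubits of $B$ such that the resulting distribution $p(\{a_i\},b\,|\,\{x_i\},y)$ violates the $n$-locality inequality, that is, $$|I|^{1/n}+|J|^{1/n}>1,$$ $$I=\frac1{2^n}\sum_{x_1,\dots,x_n}\langle A^1_{x_1}\cdots A^n_{x_n}B_0\rangle,\qquad J=\frac1{2^n}\sum_{x_1,\dots,x_n}(-1)^{\sum_i x_i}\langle A^1_{x_1}\cdots A^n_{x_n}B_1\rangle,$$ with $\langle A^1_{x_1}\cdots A^n_{x_n}B_y\rangle=\sum_{a_1,\dots,a_n,b}(-1)^{b+\sum_i a_i}\,p(\{a_i\},b\,|\,\{x_i\},y)$, and consequently has no $n$-local model $p(\{a_i\},b\,|\,\{x_i\},y)=\int\prod_i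 d\mu_i(\lambda_i)\,p_i(a_i|x_i,\lambda_i)\;p_B(b|y,\lambda_1,\dots,\lambda_n)$ with independent hidden variables $\lambda_1,\dots,\lambda_n$. **Theorem 6.** Let $2\le p\le n$, and let $\rho$ be an entangled two-qubit state that is either pure or mixed with $\delta_1=1$ and $\delta_2>0$. Let $\rho_{A_1B}=\cdots=\rho_{A_pB}=\rho$ and $\rho_{A_{p+1}B}=\cdots=\rho_{A_nB}=|\psi\rangle\langle\psi|$ with $|\psi\rangle=\frac1{\sqrt2}(|00\rangle+|11\rangle)$. Then for every choice of $\vec e,\vec f$ as above, every $\theta\in(0,\frac\pi4]$ and all positive integers $m_1,\dots,m_p$ there are sharpness parameters $\gamma_k\in(0,1)$, $k=1,2,\dots$, the same for all nodes $A_1,\dots,A_p$, such that for all integers $1\le k_i\le m_i$ $(i=1,\dots,p)$ — in particular for $k_i=m_i$ — the network state $$\rho_{A_1B}^{(k_1)}\otimes\cdots\otimes\rho_{A_pB}^{(k_p)}\otimes\rho_{A_{p+1}B}\otimes\cdots\otimes\rho_{A_nB}$$ has network nonlocality. -/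

import Mathlib

open Matrix MeasureTheory
open scoped Kronecker MatrixOrder ComplexOrder

noncomputable section

namespace StarNetwork

/-! ### Two-qubit states -/

/-- Operators on one qubit. -/
abbrev QubitOp : Type := Matrix (Fin 2) (Fin 2) ℂ

/-- Operators on two qubits; the first factor belongs to the outer node (Alice), the second one
to the central node (Bob). -/
abbrev TwoQubitOp : Type := Matrix (Fin 2 × Fin 2) (Fin 2 × Fin 2) ℂ

/-- Density matrices: positive semidefinite with trace one. -/
def IsState {ι : Type} [Fintype ι] (ρ : Matrix ι ι ℂ) : Prop :=
  ρ.PosSemidef ∧ ρ.trace = 1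

/-- The rank-one operator `|φ⟩⟨φ|`. -/
def ketBra {ι : Type} (φ : ι → ℂ) : Matrix ι ι ℂ :=
  vecMulVec φ (star φ)

/-- Pure states: `|φ⟩⟨φ|` with `φ` a unit vector. -/
def IsPureState {ι : Type} [Fintype ι] (ρ : Matrix ι ι ℂ) : Prop :=
  ∃ φ : ι → ℂ, star φ ⬝ᵥ φ = 1 ∧ ρ = ketBra φ

/-- Separable two-qubit states: convex combinations of product states. -/
def IsSeparable (ρ : TwoQubitOp) : Prop :=
  ρ ∈ convexHull ℝ {τ : TwoQubitOp | ∃ α β : QubitOp, IsState α ∧ IsState β ∧ τ = α ⊗ₖ β}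

/-- A two-qubit state is entangled if it is not separable. -/
def IsEntangled (ρ : TwoQubitOp) : Prop := ¬ IsSeparable ρ

/-- The maximally entangled vector `(|00⟩ + |11⟩) / √2`. -/
def psi : Fin 2 × Fin 2 → ℂ := fun q => if q.1 = q.2 then ((1 / Real.sqrt 2 : ℝ) : ℂ) else 0

/-- The Pauli matrices `σ_x, σ_y, σ_z`, indexed by `0, 1, 2`. -/
def pauli : Fin 3 → QubitOp :=
  ![!![0, 1; 1, 0], !![0, -Complex.I; Complex.I, 0], !![1, 0; 0, -1]]

/-- `σ_r = r₁ σ_x + r₂ σ_y + r₃ σ_z`. -/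
def sigma (r : Fin 3 → ℝ) : QubitOp := ∑ i, ((r i : ℝ) : ℂ) • pauli i

/-- The correlation matrix `t_ij = Tr (ρ (σ_i ⊗ σ_j))`. -/
def corrMatrix (ρ : TwoQubitOp) : Matrix (Fin 3) (Fin 3) ℝ :=
  Matrix.of fun i j => (ρ * (pauli i ⊗ₖ pauli j)).trace.re

/-- The matrix `R = √(t† t)`. -/
def corrAbs (ρ : TwoQubitOp) : Matrix (Fin 3) (Fin 3) ℝ :=
  CFC.sqrt ((corrMatrix ρ)ᴴ * corrMatrix ρ)

theorem corrAbs_isHermitian (ρ : TwoQubitOp) : (corrAbs ρ).IsHermitian :=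
  (Matrix.nonneg_iff_posSemidef.mp (CFC.sqrt_nonneg _)).isHermitian

/-- `δ₁`, the largest eigenvalue of `R` (Mathlib's `eigenvalues₀` lists the eigenvalues with
multiplicity in decreasing order). -/
def delta1 (ρ : TwoQubitOp) : ℝ := (corrAbs_isHermitian ρ).eigenvalues₀ ⟨0, by simp⟩

/-- `δ₂`, the second largest eigenvalue of `R`, counted with multiplicity. -/
def delta2 (ρ : TwoQubitOp) : ℝ := (corrAbs_isHermitian ρ).eigenvalues₀ ⟨1, by simp⟩

/-- Orthonormal directions `e`, `f` on Alice's Bloch sphere along which the correlation matrix has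
the singular values `δ₁` and `δ₂`. If Alice's and Bob's local bases are chosen so that `t` is
diagonal with `|t_zz| = δ₁` and `|t_xx| = δ₂`, then `e` and `f` can be taken to be the
`z`- and the `x`-axis. -/
def IsPrincipalPair (ρ : TwoQubitOp) (e f : Fin 3 → ℝ) : Prop :=
  e ⬝ᵥ e = 1 ∧ f ⬝ᵥ f = 1 ∧ e ⬝ᵥ f = 0 ∧
    (corrMatrix ρ * (corrMatrix ρ)ᵀ) *ᵥ e = (delta1 ρ ^ 2) • e ∧
    (corrMatrix ρ * (corrMatrix ρ)ᵀ) *ᵥ f = (delta2 ρ ^ 2) • f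

/-! ### Sequential measurements -/

/-- The POVM element `A_{a|x}`: `A_{0|x} = (I + cos θ σ_e + (-1)^x γ sin θ σ_f) / 2` and
`A_{1|x} = I - A_{0|x}`, with sharpness parameter `γ`. For `e`, `f` the `z`- and the `x`-axis these
are `(I + cos θ σ_z ± γ sin θ σ_x) / 2`. -/
def aliceEffect (e f : Fin 3 → ℝ) (θ γ : ℝ) (a x : Fin 2) : QubitOp :=
  let A0 : QubitOp := (1 / 2 : ℂ) • (1 + sigma (Real.cos θ • e) +
    sigma (((-1) ^ (x : ℕ) * γ * Real.sin θ) • f))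
  if a = 0 then A0 else 1 - A0

/-- One round of measurement on Alice's side, averaged over uniformly random inputs `x` and over
the outcomes `a`: `ρ ↦ ½ ∑_{a,x} (√A_{a|x} ⊗ I) ρ (√A_{a|x} ⊗ I)`. -/
def measureStep (e f : Fin 3 → ℝ) (θ γ : ℝ) (ρ : TwoQubitOp) : TwoQubitOp :=
  (1 / 2 : ℂ) • ∑ a : Fin 2, ∑ x : Fin 2,
    (CFC.sqrt (aliceEffect e f θ γ a x) ⊗ₖ (1 : QubitOp)) * ρ *
      (CFC.sqrt (aliceEffect e f θ γ a x) ⊗ₖ (1 : QubitOp))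

/-- `ρ^{(k)}`, the state shared by the `k`-th Alice and Bob: `ρ^{(1)} = ρ`, and `ρ^{(k+1)}` arises
from `ρ^{(k)}` by the measurement of the `k`-th Alice, who has sharpness `γ k`. (The value
at `k = 0` has no meaning and is not used.) -/
def seqState (e f : Fin 3 → ℝ) (θ : ℝ) (γ : ℕ → ℝ) (ρ : TwoQubitOp) : ℕ → TwoQubitOp
  | 0 => ρ
  | 1 => ρ
  | k + 2 => measureStep e f θ (γ (k + 1)) (seqState e f θ γ ρ (k + 1))

/-! ### The star network -/

/-- The state `⨂ᵢ τ i` of the star network with `n` sources; the outer nodes hold the first group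
of `n` qubits, and the central node holds the second one. -/
def networkState {n : ℕ} (τ : Fin n → TwoQubitOp) :
    Matrix ((Fin n → Fin 2) × (Fin n → Fin 2)) ((Fin n → Fin 2) × (Fin n → Fin 2)) ℂ :=
  Matrix.of fun u v => ∏ i, τ i (u.1 i, u.2 i) (v.1 i, v.2 i)

/-- The tensor product `⨂ᵢ M i` of one-qubit operators. -/
def tensorOp {n : ℕ} (M : Fin n → QubitOp) : Matrix (Fin n → Fin 2) (Fin n → Fin 2) ℂ :=
  Matrix.of fun u v => ∏ i, M i (u i) (v i)

/-- A POVM with two outcomes. -/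
structure BinaryPOVM (ι : Type) [Fintype ι] [DecidableEq ι] where
  /-- The effect of each outcome. -/
  effect : Fin 2 → Matrix ι ι ℂ
  posSemidef : ∀ a, (effect a).PosSemidef
  sum_eq_one : ∑ a, effect a = 1

/-- Conditional distributions `p({aᵢ}, b | {xᵢ}, y)` in the star network, as functions of
`a`, `b`, `x`, `y`, all inputs and outputs being binary. -/
abbrev Behavior (n : ℕ) : Type :=
  (Fin n → Fin 2) → Fin 2 → (Fin n → Fin 2) → Fin 2 → ℝ

/-- The Born rule: node `i` measures `A i (x i)` on its qubit, the central node measures `B y`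
jointly on its `n` qubits. -/
def bornBehavior {n : ℕ} (τ : Fin n → TwoQubitOp) (A : Fin n → Fin 2 → BinaryPOVM (Fin 2))
    (B : Fin 2 → BinaryPOVM (Fin n → Fin 2)) : Behavior n :=
  fun a b x y =>
    (networkState τ *
      (tensorOp (fun i => (A i (x i)).effect (a i)) ⊗ₖ (B y).effect b)).trace.re

/-- The correlator `⟨A¹_{x₁} ⋯ Aⁿ_{xₙ} B_y⟩`. -/
def correlator {n : ℕ} (P : Behavior n) (x : Fin n → Fin 2) (y : Fin 2) : ℝ :=
  ∑ a : Fin n → Fin 2, ∑ b : Fin 2, (-1) ^ ((b : ℕ) + ∑ i, (a i : ℕ)) * P a b x y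

/-- `I = 2⁻ⁿ ∑ₓ ⟨A¹_{x₁} ⋯ Aⁿ_{xₙ} B₀⟩`. -/
def corrI {n : ℕ} (P : Behavior n) : ℝ :=
  1 / 2 ^ n * ∑ x : Fin n → Fin 2, correlator P x 0

/-- `J = 2⁻ⁿ ∑ₓ (-1)^{∑ xᵢ} ⟨A¹_{x₁} ⋯ Aⁿ_{xₙ} B₁⟩`. -/
def corrJ {n : ℕ} (P : Behavior n) : ℝ :=
  1 / 2 ^ n * ∑ x : Fin n → Fin 2, (-1) ^ (∑ i, (x i : ℕ)) * correlator P x 1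

/-- `|I|^{1/n} + |J|^{1/n}`; the `n`-locality inequality says that this is at most `1`. -/
def nStar {n : ℕ} (P : Behavior n) : ℝ :=
  |corrI P| ^ (1 / n : ℝ) + |corrJ P| ^ (1 / n : ℝ)

/-- `n`-local behaviors: those with a hidden-variable model in which the sources emit independent
variables `lᵢ`, node `i` responds to `lᵢ`, and the central node responds to all of them. -/
def IsNLocal {n : ℕ} (P : Behavior n) : Prop :=
  ∃ (Λ : Fin n → Type) (_ : ∀ i, MeasurableSpace (Λ i)) (μ : ∀ i, Measure (Λ i))
    (_ : ∀ i, IsProbabilityMeasure (μ i))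
    (pA : ∀ i, Fin 2 → Fin 2 → Λ i → ℝ) (pB : Fin 2 → Fin 2 → (∀ i, Λ i) → ℝ),
    (∀ i a x, Measurable (pA i a x)) ∧ (∀ i a x l, 0 ≤ pA i a x l) ∧
    (∀ i x l, ∑ a, pA i a x l = 1) ∧
    (∀ b y, Measurable (pB b y)) ∧ (∀ b y l, 0 ≤ pB b y l) ∧
    (∀ y l, ∑ b, pB b y l = 1) ∧
    ∀ a b x y, P a b x y =
      ∫ l, (∏ i, pA i (a i) (x i) (l i)) * pB b y l ∂(Measure.pi μ)

/-- The star-network state `⨂ᵢ τ i` is network nonlocal: suitable binary measurements of the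
nodes give a behavior that violates the `n`-locality inequality and has no `n`-local model. -/
def IsNetworkNonlocal {n : ℕ} (τ : Fin n → TwoQubitOp) : Prop :=
  ∃ (A : Fin n → Fin 2 → BinaryPOVM (Fin 2)) (B : Fin 2 → BinaryPOVM (Fin n → Fin 2)),
    1 < nStar (bornBehavior τ A B) ∧ ¬ IsNLocal (bornBehavior τ A B)

end StarNetwork

end

noncomputable section

namespace StarNetwork

/-! ### Pauli algebra -/

/-! The measurements that disturb the state need not be the ones that witness nonlocality, so every
Alice may use the same tiny sharpness `γ`. Put s = sin θ √(1 − γ²). In the Heisenberg picture one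
averaged Lüders round fixes the axes e and f up to scalars: e is multiplied by s + cos²θ/(1 + s),
and f by s + γ² sin²θ/(1 + s) (`luders_sigma`, `trace_measureStep`). At γ = 0 these factors are 1
and sin θ > 0. After K rounds the correlations along e and f would thus be δ₁ = 1 and sinᴷθ · δ₂ >
0, with sum of squares strictly above 1. By continuity this survives for some small γ > 0
(`exists_sharpness`). Since both factors are at most 1, one large K serves all nodes.

Given correlations at least α and β at every node with α² + β² > 1, let r = √(α² + β²). The outer
nodes measure along (α e ± β f)/r and the center measures product observables. Then I and J are
products over the nodes, and |I|^{1/n} + |J|^{1/n} ≥ r > 1 (`isNetworkNonlocal_of_correlations`).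
That this excludes an n-local model is the n-locality inequality, which follows from Fubini and
AM-GM (`nStar_le_one_of_isNLocal`).

An entangled pure state reduces to δ₁ = 1, δ₂ > 0: the eigenvalues of tᵀt are 1 or the squared
concurrence, which vanishes only for product vectors (`delta_of_isPureState`). -/

theorem sigma_eq (v : Fin 3 → ℝ) :
    sigma v = !![(v 2 : ℂ), v 0 - v 1 * Complex.I; v 0 + v 1 * Complex.I, -v 2] := by
  ext i j
  fin_cases i <;> fin_cases j <;>
    simp [sigma, pauli, Fin.sum_univ_three, Matrix.sum_apply, sub_eq_add_neg]

theorem sigma_add (v w : Fin 3 → ℝ) : sigma (v + w) = sigma v + sigma w := by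
  simp [sigma, add_smul, Finset.sum_add_distrib]

theorem sigma_smul (c : ℝ) (v : Fin 3 → ℝ) : sigma (c • v) = (c : ℂ) • sigma v := by
  simp [sigma, mul_smul, Finset.smul_sum]

theorem sigma_neg (v : Fin 3 → ℝ) : sigma (-v) = -sigma v := by
  simp [sigma]

theorem sigma_zero : sigma 0 = 0 := by
  simp [sigma]

theorem sigma_conjTranspose (v : Fin 3 → ℝ) : (sigma v)ᴴ = sigma v := by
  rw [sigma_eq]
  ext i j
  fin_cases i <;> fin_cases j <;> simp [sub_eq_add_neg]

theorem sigma_mul_self (v : Fin 3 → ℝ) : sigma v * sigma v = ((v ⬝ᵥ v : ℝ) : ℂ) • 1 := by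
  rw [sigma_eq]
  ext i j
  fin_cases i <;> fin_cases j <;>
    simp [Matrix.mul_apply, dotProduct, Fin.sum_univ_three] <;>
    ring_nf <;> simp [Complex.I_sq]

theorem sigma_anticomm (v w : Fin 3 → ℝ) :
    sigma v * sigma w + sigma w * sigma v = ((2 * (v ⬝ᵥ w) : ℝ) : ℂ) • 1 := by
  rw [sigma_eq, sigma_eq]
  ext i j
  fin_cases i <;> fin_cases j <;>
    simp [dotProduct, Fin.sum_univ_three] <;>
    ring_nf <;> simp [Complex.I_sq]

theorem sigma_conj (v w : Fin 3 → ℝ) :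
    sigma v * sigma w * sigma v =
      ((2 * (v ⬝ᵥ w) : ℝ) : ℂ) • sigma v - ((v ⬝ᵥ v : ℝ) : ℂ) • sigma w := by
  rw [eq_sub_of_add_eq (sigma_anticomm v w), sub_mul, mul_assoc, sigma_mul_self]
  simp

/-! ### Projective measurements from Hermitian involutions, and positivity of qubit operators. -/

theorem posSemidef_half_one_add {ι : Type} [Fintype ι] [DecidableEq ι] {H : Matrix ι ι ℂ}
    (hH : Hᴴ = H) (hH2 : H * H = 1) : ((1 / 2 : ℂ) • (1 + H)).PosSemidef := by
  have h : ((1 / 2 : ℂ) • (1 + H)) = ((1 / 2 : ℂ) • (1 + H))ᴴ * ((1 / 2 : ℂ) • (1 + H)) := by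
    have h2 : ((1 / 2 : ℂ) • (1 + H))ᴴ = (1 / 2 : ℂ) • (1 + H) := by
      simp [conjTranspose_smul, hH]
    rw [h2, smul_mul_smul_comm, add_mul, mul_add, mul_add, hH2]
    simp only [one_mul, mul_one]
    rw [show (1 : Matrix ι ι ℂ) + H + (H + 1) = (2 : ℂ) • (1 + H) by rw [two_smul]; abel, smul_smul]
    norm_num
  rw [h]
  exact posSemidef_conjTranspose_mul_self _

/-- The projection onto the `+1` eigenspace of `H` and its complement. -/
def BinaryPOVM.ofInvolution {ι : Type} [Fintype ι] [DecidableEq ι] (H : Matrix ι ι ℂ)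
    (hH : Hᴴ = H) (hH2 : H * H = 1) : BinaryPOVM ι where
  effect a := if a = 0 then (1 / 2 : ℂ) • (1 + H) else (1 / 2 : ℂ) • (1 + -H)
  posSemidef a := by
    split_ifs
    · exact posSemidef_half_one_add hH hH2
    · exact posSemidef_half_one_add (by simp [hH]) (by simp [hH2])
  sum_eq_one := by
    simp only [Fin.sum_univ_two, ↓reduceIte, one_ne_zero]
    rw [← smul_add, show (1 : Matrix ι ι ℂ) + H + (1 + -H) = (2 : ℂ) • 1 by rw [two_smul]; abel,
      smul_smul]
    norm_num

theorem BinaryPOVM.ofInvolution_signed_sum {ι : Type} [Fintype ι] [DecidableEq ι]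
    (H : Matrix ι ι ℂ) (hH : Hᴴ = H) (hH2 : H * H = 1) :
    ∑ a : Fin 2, (-1 : ℂ) ^ (a : ℕ) • (ofInvolution H hH hH2).effect a = H := by
  simp only [ofInvolution, Fin.sum_univ_two, ↓reduceIte, one_ne_zero, Fin.val_zero, Fin.val_one,
    pow_zero, pow_one, one_smul, neg_smul, ← smul_neg]
  rw [← smul_add, show (1 : Matrix ι ι ℂ) + H + -(1 + -H) = (2 : ℂ) • H by rw [two_smul]; abel,
      smul_smul]
  norm_num

/-- Spectral decomposition: with r = |v| the operator is (a + r)P₊ + (a − r)P₋, where P± are the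
eigenprojections of σ along v/r. -/
theorem posSemidef_smul_one_add_sigma {a : ℝ} {v : Fin 3 → ℝ} (ha : 0 ≤ a) (hv : v ⬝ᵥ v ≤ a ^ 2) :
    ((a : ℂ) • (1 : QubitOp) + sigma v).PosSemidef := by
  have h0 : 0 ≤ v ⬝ᵥ v := Finset.sum_nonneg fun i _ => mul_self_nonneg _
  obtain h | h := eq_or_ne v 0
  · subst h
    rw [sigma_zero, add_zero]
    exact PosSemidef.one.smul (by exact_mod_cast ha)
  set r := Real.sqrt (v ⬝ᵥ v) with hr
  have hrr : r * r = v ⬝ᵥ v := Real.mul_self_sqrt h0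
  have hr0 : 0 < r := Real.sqrt_pos.2 (lt_of_le_of_ne h0 fun h' => h (dotProduct_self_eq_zero.1 h'.symm))
  have hra : r ≤ a := by nlinarith
  have hn : sigma (r⁻¹ • v) * sigma (r⁻¹ • v) = 1 := by
    rw [sigma_mul_self, smul_dotProduct, dotProduct_smul, ← hrr]
    simp [hr0.ne']
  have e1 := (posSemidef_half_one_add (sigma_conjTranspose (r⁻¹ • v)) hn).smul
    (show (0 : ℂ) ≤ ((a + r : ℝ) : ℂ) by exact_mod_cast by linarith)
  have e2 := (posSemidef_half_one_add (H := -sigma (r⁻¹ • v))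
    (by simp [sigma_conjTranspose]) (by simp [hn])).smul
    (show (0 : ℂ) ≤ ((a - r : ℝ) : ℂ) by exact_mod_cast by linarith)
  convert e1.add e2 using 1
  have hrc : (r : ℂ) ≠ 0 := by exact_mod_cast hr0.ne'
  rw [sigma_smul]
  push_cast
  match_scalars
  · ring
  · field_simp; ring

/-! ### The averaged Lüders channel -/

/-- The parameter s = √(1 − |v|²) makes the root explicit: with q² = 1 + s one has |v|² = q²(2 −
q²), so squaring q/2 + σ_v/(2q) returns the effect. -/
theorem sqrt_half_one_add_sigma {v : Fin 3 → ℝ} {s : ℝ} (hs : 0 ≤ s) (hv : v ⬝ᵥ v = 1 - s ^ 2) :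
    CFC.sqrt ((1 / 2 : ℂ) • (1 + sigma v)) =
      ((Real.sqrt (1 + s) / 2 : ℝ) : ℂ) • (1 : QubitOp) +
        sigma ((1 / (2 * Real.sqrt (1 + s))) • v) := by
  have hq : 0 < Real.sqrt (1 + s) := Real.sqrt_pos.2 (by linarith)
  have hqq : Real.sqrt (1 + s) ^ 2 = 1 + s := Real.sq_sqrt (by linarith)
  set q := Real.sqrt (1 + s)
  have hs1 : s ≤ 1 := by
    have h0 : 0 ≤ v ⬝ᵥ v := Finset.sum_nonneg fun i _ => mul_self_nonneg _
    nlinarith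
  have hvv : v ⬝ᵥ v = q ^ 2 * (2 - q ^ 2) := by rw [hv, hqq]; ring
  apply CFC.sqrt_unique
  · rw [add_mul, mul_add, mul_add, sigma_mul_self, smul_dotProduct, dotProduct_smul, hvv,
      sigma_smul]
    simp only [Algebra.smul_mul_assoc, Algebra.mul_smul_comm, one_mul, mul_one,
      smul_eq_mul]
    have hqc : (q : ℂ) ≠ 0 := by exact_mod_cast hq.ne'
    push_cast
    match_scalars
    · field_simp; ring
    · field_simp; norm_num
  · refine Matrix.nonneg_iff_posSemidef.mpr (posSemidef_smul_one_add_sigma (by positivity) ?_)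
    rw [smul_dotProduct, dotProduct_smul, hvv]
    simp only [smul_eq_mul]
    field_simp
    nlinarith

/-- The two effects have opposite Bloch vectors and the same s, so the terms odd in v cancel. What
remains is σ_w and σ_v σ_w σ_v, and the latter is given by `sigma_conj`. -/
theorem luders_sigma {v : Fin 3 → ℝ} (w : Fin 3 → ℝ) {s : ℝ} (hs : 0 ≤ s)
    (hv : v ⬝ᵥ v = 1 - s ^ 2) :
    CFC.sqrt ((1 / 2 : ℂ) • (1 + sigma v)) * sigma w * CFC.sqrt ((1 / 2 : ℂ) • (1 + sigma v)) +
      CFC.sqrt (1 - (1 / 2 : ℂ) • (1 + sigma v)) * sigma w *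
        CFC.sqrt (1 - (1 / 2 : ℂ) • (1 + sigma v)) =
      sigma (s • w + ((v ⬝ᵥ w) / (1 + s)) • v) := by
  have h1 : 1 - (1 / 2 : ℂ) • (1 + sigma v) = (1 / 2 : ℂ) • (1 + sigma (-v)) := by
    rw [sigma_neg]
    match_scalars <;> norm_num
  have hq : 0 < Real.sqrt (1 + s) := Real.sqrt_pos.2 (by linarith)
  have hqq : Real.sqrt (1 + s) ^ 2 = 1 + s := Real.sq_sqrt (by linarith)
  rw [h1, sqrt_half_one_add_sigma hs hv, sqrt_half_one_add_sigma hs (by simpa using hv)]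
  set q := Real.sqrt (1 + s)
  have hs' : s = q ^ 2 - 1 := by linarith
  have hqc : (q : ℂ) ≠ 0 := by exact_mod_cast hq.ne'
  have hvv : v ⬝ᵥ v = q ^ 2 * (2 - q ^ 2) := by rw [hv, hqq]; ring
  simp only [sigma_smul, sigma_neg, sigma_add, smul_neg, add_mul, mul_add, Algebra.smul_mul_assoc,
    Algebra.mul_smul_comm, one_mul, mul_one, neg_mul, mul_neg, sigma_conj, hvv, hs']
  push_cast
  have hq2 : (1 + ((q : ℂ) ^ 2 - 1)) ≠ 0 := by simpa using hqc
  match_scalars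
  · field_simp; ring
  · ring
  · field_simp; ring
  · ring

theorem aliceEffect_zero (e f : Fin 3 → ℝ) (θ γ : ℝ) (x : Fin 2) :
    aliceEffect e f θ γ 0 x = (1 / 2 : ℂ) •
      (1 + sigma (Real.cos θ • e + ((-1) ^ (x : ℕ) * γ * Real.sin θ) • f)) := by
  simp [aliceEffect, sigma_add, add_assoc]

theorem aliceEffect_one (e f : Fin 3 → ℝ) (θ γ : ℝ) (x : Fin 2) :
    aliceEffect e f θ γ 1 x = 1 - (1 / 2 : ℂ) •
      (1 + sigma (Real.cos θ • e + ((-1) ^ (x : ℕ) * γ * Real.sin θ) • f)) := by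
  simp [aliceEffect, sigma_add, add_assoc]

/-- The factor by which one round of measurement reduces the off-axis part of the correlations. -/
def contraction (θ γ : ℝ) : ℝ := Real.sin θ * Real.sqrt (1 - γ ^ 2)

theorem trace_kronecker_conj_mul (S M N : QubitOp) (ρ : TwoQubitOp) :
    ((S ⊗ₖ (1 : QubitOp)) * ρ * (S ⊗ₖ (1 : QubitOp)) * (M ⊗ₖ N)).trace =
      (ρ * ((S * M * S) ⊗ₖ N)).trace := by
  rw [Matrix.mul_assoc, Matrix.mul_assoc, Matrix.trace_mul_comm, Matrix.mul_assoc,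
    ← Matrix.mul_kronecker_mul, ← Matrix.mul_kronecker_mul]
  simp

/-- The Heisenberg dual of one round. The Bloch vectors for x = 0, 1 differ in the sign of their
f-component, so averaging over x removes the terms mixing e and f. -/
theorem trace_measureStep {e f : Fin 3 → ℝ} (he : e ⬝ᵥ e = 1) (hf : f ⬝ᵥ f = 1)
    (hef : e ⬝ᵥ f = 0) {θ γ : ℝ} (hθ : 0 ≤ Real.sin θ) (hγ : γ ^ 2 ≤ 1)
    (ρ : TwoQubitOp) (w : Fin 3 → ℝ) (N : QubitOp) :
    (measureStep e f θ γ ρ * (sigma w ⊗ₖ N)).trace =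
      (ρ * (sigma (contraction θ γ • w +
        (Real.cos θ ^ 2 * (e ⬝ᵥ w) / (1 + contraction θ γ)) • e +
        (γ ^ 2 * Real.sin θ ^ 2 * (f ⬝ᵥ w) / (1 + contraction θ γ)) • f) ⊗ₖ N)).trace := by
  have hs : 0 ≤ contraction θ γ := mul_nonneg hθ (Real.sqrt_nonneg _)
  have hfe : f ⬝ᵥ e = 0 := by rw [dotProduct_comm, hef]
  have hv (x : Fin 2) : (Real.cos θ • e + ((-1) ^ (x : ℕ) * γ * Real.sin θ) • f) ⬝ᵥ
      (Real.cos θ • e + ((-1) ^ (x : ℕ) * γ * Real.sin θ) • f) = 1 - contraction θ γ ^ 2 := by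
    have h1 : ((-1 : ℝ) ^ (x : ℕ)) ^ 2 = 1 := by rw [← pow_mul, mul_comm, pow_mul]; simp
    have h2 := Real.sin_sq_add_cos_sq θ
    rw [contraction, mul_pow, Real.sq_sqrt (by linarith)]
    simp only [add_dotProduct, dotProduct_add, smul_dotProduct, dotProduct_smul, he, hf, hef, hfe,
      smul_eq_mul]
    linear_combination γ ^ 2 * Real.sin θ ^ 2 * h1 + h2
  simp only [measureStep, Matrix.smul_mul, Finset.sum_mul, Matrix.trace_smul, Matrix.trace_sum,
    trace_kronecker_conj_mul]
  rw [Finset.sum_comm]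
  simp only [Fin.sum_univ_two (f := fun a => Matrix.trace (ρ * ((CFC.sqrt (aliceEffect e f θ γ a _)
    * _ * _) ⊗ₖ N))), aliceEffect_zero, aliceEffect_one, ← Matrix.trace_add, ← Matrix.mul_add,
    ← Matrix.add_kronecker]
  simp only [luders_sigma w hs (hv _), Fin.sum_univ_two, ← Matrix.trace_add, ← Matrix.mul_add,
    ← Matrix.add_kronecker, ← Matrix.trace_smul, ← Matrix.mul_smul, ← Matrix.smul_kronecker]
  congr 3
  have hc : (1 + contraction θ γ) ≠ 0 := by positivity
  rw [← sigma_add, show (1 / 2 : ℂ) = ((1 / 2 : ℝ) : ℂ) by simp, ← sigma_smul]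
  congr 1
  simp only [add_dotProduct, smul_dotProduct, smul_eq_mul, Fin.val_zero, Fin.val_one, pow_zero,
    pow_one]
  match_scalars <;> field_simp <;> ring

end StarNetwork

end

noncomputable section

namespace StarNetwork

/-! ### Tensor products and the Born rule in the star network -/

theorem sum_pi_prod_eq {n : ℕ} {R : Type*} [CommSemiring R] {κ : Type*} [Fintype κ]
    (g : Fin n → κ → R) : ∑ x : Fin n → κ, ∏ i, g i (x i) = ∏ i, ∑ a, g i a := by
  classical
  rw [Finset.prod_univ_sum, Fintype.piFinset_univ]

theorem trace_networkState_mul {n : ℕ} (τ : Fin n → TwoQubitOp) (M N : Fin n → QubitOp) :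
    (networkState τ * (tensorOp M ⊗ₖ tensorOp N)).trace = ∏ i, (τ i * (M i ⊗ₖ N i)).trace := by
  have h (i : Fin n) : (τ i * (M i ⊗ₖ N i)).trace =
      ∑ q : Fin 2 × Fin 2, ∑ r : Fin 2 × Fin 2, τ i q r * (M i r.1 q.1 * N i r.2 q.2) := by
    simp [Matrix.trace, Matrix.mul_apply, Matrix.kroneckerMap_apply]
  simp only [h, ← sum_pi_prod_eq]
  simp only [Matrix.trace, Matrix.diag, Matrix.mul_apply, Matrix.kroneckerMap_apply, networkState,
    tensorOp, Matrix.of_apply, ← Finset.prod_mul_distrib]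
  refine (Fintype.sum_equiv (Equiv.arrowProdEquivProdArrow _ _ _) _ _ fun q => ?_).symm
  exact Fintype.sum_equiv (Equiv.arrowProdEquivProdArrow _ _ _) _ _ fun r => rfl

theorem tensorOp_mul {n : ℕ} (M N : Fin n → QubitOp) :
    tensorOp M * tensorOp N = tensorOp fun i => M i * N i := by
  ext u v
  simp only [tensorOp, Matrix.mul_apply, Matrix.of_apply, ← Finset.prod_mul_distrib]
  exact sum_pi_prod_eq fun i w => M i (u i) w * N i w (v i)

theorem tensorOp_one {n : ℕ} : tensorOp (fun _ : Fin n => (1 : QubitOp)) = 1 := by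
  ext u v
  simp only [tensorOp, Matrix.of_apply, Matrix.one_apply]
  rw [Finset.prod_ite_zero]
  simp [funext_iff]

theorem tensorOp_conjTranspose {n : ℕ} (M : Fin n → QubitOp) :
    (tensorOp M)ᴴ = tensorOp fun i => (M i)ᴴ := by
  ext u v
  simp [tensorOp]

theorem tensorOp_sum_smul {n : ℕ} (c : Fin 2 → ℂ) (M : Fin n → Fin 2 → QubitOp) :
    tensorOp (fun i => ∑ a, c a • M i a) =
      ∑ a : Fin n → Fin 2, (∏ i, c (a i)) • tensorOp fun i => M i (a i) := by
  ext u v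
  simp only [tensorOp, Matrix.of_apply, Matrix.sum_apply, Matrix.smul_apply, smul_eq_mul,
    ← Finset.prod_mul_distrib]
  exact (sum_pi_prod_eq fun i a => c a * M i a (u i) (v i)).symm

theorem sum_kronecker {ι l m p q : Type*} (s : Finset ι) (M : ι → Matrix l m ℂ)
    (N : Matrix p q ℂ) : (∑ a ∈ s, M a) ⊗ₖ N = ∑ a ∈ s, M a ⊗ₖ N := by
  ext u v
  simp [Matrix.sum_apply, Matrix.kroneckerMap_apply, Finset.sum_mul]

theorem kronecker_sum {ι l m p q : Type*} (s : Finset ι) (M : Matrix l m ℂ)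
    (N : ι → Matrix p q ℂ) : M ⊗ₖ (∑ b ∈ s, N b) = ∑ b ∈ s, M ⊗ₖ N b := by
  ext u v
  simp [Matrix.sum_apply, Matrix.kroneckerMap_apply, Finset.mul_sum]

theorem correlator_bornBehavior {n : ℕ} (τ : Fin n → TwoQubitOp)
    (A : Fin n → Fin 2 → BinaryPOVM (Fin 2)) (B : Fin 2 → BinaryPOVM (Fin n → Fin 2))
    (x : Fin n → Fin 2) (y : Fin 2) :
    correlator (bornBehavior τ A B) x y =
      (networkState τ * (tensorOp (fun i => ∑ a : Fin 2, (-1 : ℂ) ^ (a : ℕ) • (A i (x i)).effect a) ⊗ₖ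
        ∑ b : Fin 2, (-1 : ℂ) ^ (b : ℕ) • (B y).effect b)).trace.re := by
  rw [tensorOp_sum_smul (fun a => (-1 : ℂ) ^ (a : ℕ)) fun i a => (A i (x i)).effect a]
  simp only [sum_kronecker, kronecker_sum, Finset.mul_sum, Matrix.trace_sum,
    Complex.re_sum, correlator, bornBehavior]
  rw [Finset.sum_comm]
  refine Finset.sum_congr rfl fun b _ => Finset.sum_congr rfl fun a _ => ?_
  simp only [Matrix.smul_kronecker, Matrix.kronecker_smul, Matrix.mul_smul, Matrix.trace_smul,
    smul_eq_mul, ← mul_assoc]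
  rw [Finset.prod_pow_eq_pow_sum, ← pow_add]
  have : ((-1 : ℂ) ^ ((b : ℕ) + ∑ i, (a i : ℕ))) = (((-1) ^ ((b : ℕ) + ∑ i, (a i : ℕ)) : ℝ) : ℂ) := by
    push_cast; rfl
  rw [this, Complex.re_ofReal_mul]

/-! ### The `n`-locality inequality -/

theorem geom_mean_add_le_one {n : ℕ} (hn : 0 < n) (u w : Fin n → ℝ) (hu : ∀ i, 0 ≤ u i)
    (hw : ∀ i, 0 ≤ w i) (huw : ∀ i, u i + w i ≤ 1) :
    (∏ i, u i) ^ (1 / n : ℝ) + (∏ i, w i) ^ (1 / n : ℝ) ≤ 1 := by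
  have hn' : (0 : ℝ) < n := by exact_mod_cast hn
  have key (z : Fin n → ℝ) (hz : ∀ i, 0 ≤ z i) : (∏ i, z i) ^ (1 / n : ℝ) ≤ (∑ i, z i) / n := by
    have := Real.geom_mean_le_arith_mean Finset.univ (fun _ => (1 : ℝ)) z (by simp) (by simpa)
      (fun i _ => hz i)
    simpa using this
  calc _ ≤ (∑ i, u i) / n + (∑ i, w i) / n := add_le_add (key u hu) (key w hw)
    _ = (∑ i, (u i + w i)) / n := by rw [Finset.sum_add_distrib, add_div]
    _ ≤ (∑ _i : Fin n, (1 : ℝ)) / n := by gcongr with i; exact huw i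
    _ = 1 := by simp [hn'.ne']

theorem integrable_of_bounded {α : Type*} [MeasurableSpace α] {μ : Measure α}
    [IsFiniteMeasure μ] {g : α → ℝ} (hg : Measurable g) (C : ℝ) (hC : ∀ l, |g l| ≤ C) :
    Integrable g μ :=
  Integrable.of_bound hg.aestronglyMeasurable C (Filter.Eventually.of_forall hC)

theorem le_one_of_sum_eq_one {q : Fin 2 → ℝ} (h0 : ∀ a, 0 ≤ q a) (h1 : ∑ a, q a = 1) (a : Fin 2) :
    q a ≤ 1 :=
  h1 ▸ Finset.single_le_sum (fun a _ => h0 a) (Finset.mem_univ a)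

theorem abs_signed_sum_le_one {q : Fin 2 → ℝ} (h0 : ∀ a, 0 ≤ q a) (h1 : ∑ a, q a = 1) :
    |∑ a : Fin 2, (-1) ^ (a : ℕ) * q a| ≤ 1 := by
  have h00 := h0 0
  have h01 := h0 1
  simp only [Fin.sum_univ_two, Fin.val_zero, Fin.val_one, pow_zero, pow_one] at h1 ⊢
  rw [abs_le]
  constructor <;> linarith

section NLocal

variable {n : ℕ} {Λ : Fin n → Type} [∀ i, MeasurableSpace (Λ i)] (μ : ∀ i, Measure (Λ i))
  [∀ i, IsProbabilityMeasure (μ i)] {pA : ∀ i, Fin 2 → Fin 2 → Λ i → ℝ}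
  {pB : Fin 2 → Fin 2 → (∀ i, Λ i) → ℝ}

/-- Product weights make the integrand factor into one function per source times the center's mean
response. That response has absolute value at most 1, and Fubini splits the rest. The weights 1 and
(−1)ˣ yield I and J. -/
theorem abs_weighted_correlator_le (hAm : ∀ i a x, Measurable (pA i a x))
    (hA0 : ∀ i a x l, 0 ≤ pA i a x l) (hA1 : ∀ i x l, ∑ a, pA i a x l = 1)
    (hBm : ∀ b y, Measurable (pB b y)) (hB0 : ∀ b y l, 0 ≤ pB b y l)
    (hB1 : ∀ y l, ∑ b, pB b y l = 1) {P : Behavior n}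
    (hP : ∀ a b x y, P a b x y = ∫ l, (∏ i, pA i (a i) (x i) (l i)) * pB b y l ∂(Measure.pi μ))
    (ε : Fin 2 → ℝ) (y : Fin 2) :
    |∑ x : Fin n → Fin 2, (∏ i, ε (x i)) * correlator P x y| ≤
      ∏ i, ∫ l, |∑ x, ε x * ∑ a : Fin 2, (-1) ^ (a : ℕ) * pA i a x l| ∂(μ i) := by
  have hint (a : Fin n → Fin 2) (b : Fin 2) (x : Fin n → Fin 2) :
      Integrable (fun l : ∀ i, Λ i => (∏ i, pA i (a i) (x i) (l i)) * pB b y l)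
      (Measure.pi μ) := by
    refine integrable_of_bounded ?_ 1 fun l => ?_
    · exact (Finset.measurable_prod _ fun i _ => (hAm i (a i) (x i)).comp (measurable_pi_apply i)).mul
        (hBm b y)
    · have h0 : 0 ≤ ∏ i, pA i (a i) (x i) (l i) := Finset.prod_nonneg fun i _ => hA0 _ _ _ _
      have h1 : ∏ i, pA i (a i) (x i) (l i) ≤ 1 := Finset.prod_le_one (fun i _ => hA0 _ _ _ _)
        fun i _ => le_one_of_sum_eq_one (fun a => hA0 i a (x i) (l i)) (hA1 i (x i) (l i)) (a i)
      rw [abs_of_nonneg (mul_nonneg h0 (hB0 b y l))]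
      exact mul_le_one₀ h1 (hB0 b y l)
        (le_one_of_sum_eq_one (fun b => hB0 b y l) (hB1 y l) b)
  have hsum : ∑ x : Fin n → Fin 2, (∏ i, ε (x i)) * correlator P x y =
      ∫ l, (∏ i, ∑ x, ε x * ∑ a : Fin 2, (-1) ^ (a : ℕ) * pA i a x (l i)) *
        ∑ b : Fin 2, (-1) ^ (b : ℕ) * pB b y l ∂(Measure.pi μ) := by
    simp only [correlator, hP, ← integral_const_mul]
    have hint2 (x a : Fin n → Fin 2) (b : Fin 2) :
        Integrable (fun l : ∀ i, Λ i => (-1 : ℝ) ^ ((b : ℕ) + ∑ i, (a i : ℕ)) *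
        ((∏ i, pA i (a i) (x i) (l i)) * pB b y l)) (Measure.pi μ) := (hint a b x).const_mul _
    have hint3 (x a : Fin n → Fin 2) := integrable_finsetSum (Finset.univ : Finset (Fin 2))
      fun b _ => hint2 x a b
    have hint4 (x : Fin n → Fin 2) := integrable_finsetSum (Finset.univ : Finset (Fin n → Fin 2))
      fun a _ => hint3 x a
    simp only [← integral_finsetSum _ fun b _ => hint2 _ _ b,
      ← integral_finsetSum _ fun a _ => hint3 _ a, ← integral_const_mul]
    rw [← integral_finsetSum _ fun x _ => (hint4 x).const_mul _]
    congr 1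
    ext l
    rw [← sum_pi_prod_eq fun i x => ε x * ∑ a : Fin 2, (-1) ^ (a : ℕ) * pA i a x (l i),
      Finset.sum_mul]
    refine Finset.sum_congr rfl fun x _ => ?_
    rw [Finset.prod_mul_distrib, mul_assoc]
    congr 1
    rw [← sum_pi_prod_eq fun i (a : Fin 2) => (-1) ^ (a : ℕ) * pA i a (x i) (l i), Finset.sum_mul]
    refine Finset.sum_congr rfl fun a _ => ?_
    rw [Finset.mul_sum]
    refine Finset.sum_congr rfl fun b _ => ?_
    rw [Finset.prod_mul_distrib, Finset.prod_pow_eq_pow_sum, pow_add]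
    ring
  rw [hsum, ← integral_fintype_prod_eq_prod]
  have hbd (i) (l : Λ i) : |∑ x, ε x * ∑ a : Fin 2, (-1) ^ (a : ℕ) * pA i a x l| ≤
      ∑ x, |ε x| := by
    refine (Finset.abs_sum_le_sum_abs _ _).trans (Finset.sum_le_sum fun x _ => ?_)
    rw [abs_mul]
    exact mul_le_of_le_one_right (abs_nonneg _)
      (abs_signed_sum_le_one (fun a => hA0 i a x l) (hA1 i x l))
  have hmeas (i) : Measurable fun l : Λ i =>
      |∑ x, ε x * ∑ a : Fin 2, (-1) ^ (a : ℕ) * pA i a x l| := by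
    fun_prop (disch := exact hAm _ _ _)
  rw [← Real.norm_eq_abs]
  refine norm_integral_le_of_norm_le (integrable_of_bounded ?_ (∏ _i : Fin n, ∑ x, |ε x|) ?_)
    (Filter.Eventually.of_forall fun l => ?_)
  · exact Finset.measurable_prod _ fun i _ => (hmeas i).comp (measurable_pi_apply i)
  · intro l
    rw [abs_of_nonneg (Finset.prod_nonneg fun i _ => abs_nonneg _)]
    exact Finset.prod_le_prod (fun i _ => abs_nonneg _) fun i _ => hbd i (l i)
  · rw [Real.norm_eq_abs, abs_mul, Finset.abs_prod]
    exact mul_le_of_le_one_right (Finset.prod_nonneg fun i _ => abs_nonneg _)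
      (abs_signed_sum_le_one (fun b => hB0 b y l) (hB1 y l))

end NLocal

theorem half_pow_mul_prod {n : ℕ} (g : Fin n → ℝ) :
    1 / 2 ^ n * ∏ i, g i = ∏ i, (1 / 2 * g i) := by
  rw [Finset.prod_mul_distrib]
  simp

theorem nStar_le_one_of_isNLocal {n : ℕ} (hn : 0 < n) {P : Behavior n} (h : IsNLocal P) :
    nStar P ≤ 1 := by
  obtain ⟨Λ, _, μ, _, pA, pB, hAm, hA0, hA1, hBm, hB0, hB1, hP⟩ := h
  have hI := abs_weighted_correlator_le μ hAm hA0 hA1 hBm hB0 hB1 hP (fun _ => 1) 0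
  have hJ := abs_weighted_correlator_le μ hAm hA0 hA1 hBm hB0 hB1 hP (fun x => (-1) ^ (x : ℕ)) 1
  simp only [Finset.prod_const_one, one_mul, Finset.prod_pow_eq_pow_sum] at hI hJ
  set E : ∀ i, Fin 2 → Λ i → ℝ := fun i x l => ∑ a : Fin 2, (-1) ^ (a : ℕ) * pA i a x l with hE
  have hE1 (i x l) : |E i x l| ≤ 1 := abs_signed_sum_le_one (fun a => hA0 i a x l) (hA1 i x l)
  have hEm (i x) : Measurable (E i x) := by
    simp only [hE]
    fun_prop (disch := exact hAm _ _ _)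
  have hint (i) (g : Λ i → ℝ) (hg : Measurable g) (hb : ∀ l, |g l| ≤ 2) :
      Integrable g (μ i) := integrable_of_bounded hg 2 hb
  replace hI : |∑ x, correlator P x 0| ≤ ∏ i, ∫ l, |E i 0 l + E i 1 l| ∂(μ i) := by
    simpa only [hE, Fin.sum_univ_two, one_mul] using hI
  replace hJ : |∑ x : Fin n → Fin 2, (-1) ^ (∑ i, (x i : ℕ)) * correlator P x 1| ≤
      ∏ i, ∫ l, |E i 0 l - E i 1 l| ∂(μ i) := by
    simpa only [hE, Fin.sum_univ_two, Fin.val_zero, Fin.val_one, pow_zero, pow_one, one_mul,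
      neg_one_mul, ← sub_eq_add_neg] using hJ
  have h2 : (0 : ℝ) ≤ 1 / 2 ^ n := by positivity
  refine le_trans (add_le_add (Real.rpow_le_rpow (abs_nonneg _) ?_ (by positivity))
    (Real.rpow_le_rpow (abs_nonneg _) ?_ (by positivity)))
    (geom_mean_add_le_one hn (fun i => 1 / 2 * ∫ l, |E i 0 l + E i 1 l| ∂(μ i))
      (fun i => 1 / 2 * ∫ l, |E i 0 l - E i 1 l| ∂(μ i)) ?_ ?_ ?_)
  · rw [corrI, abs_mul, abs_of_nonneg h2, ← half_pow_mul_prod]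
    exact mul_le_mul_of_nonneg_left hI h2
  · rw [corrJ, abs_mul, abs_of_nonneg h2, ← half_pow_mul_prod]
    exact mul_le_mul_of_nonneg_left hJ h2
  · exact fun i => mul_nonneg (by norm_num) (integral_nonneg fun _ => abs_nonneg _)
  · exact fun i => mul_nonneg (by norm_num) (integral_nonneg fun _ => abs_nonneg _)
  · intro i
    -- For reals this sum is 2 max(|E₀|, |E₁|); it supplies the hypothesis u + w ≤ 1 of the AM-GM
    -- bound.
    have hb (l) : |E i 0 l + E i 1 l| + |E i 0 l - E i 1 l| ≤ 2 := by
      have h0 := abs_le.1 (hE1 i 0 l)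
      have h1 := abs_le.1 (hE1 i 1 l)
      rcases abs_cases (E i 0 l + E i 1 l) with h | h <;>
        rcases abs_cases (E i 0 l - E i 1 l) with h' | h' <;> linarith
    have i1 := hint i (fun l => |E i 0 l + E i 1 l|) (by fun_prop) fun l => by
      rw [abs_abs]; linarith [hb l, abs_nonneg (E i 0 l - E i 1 l)]
    have i2 := hint i (fun l => |E i 0 l - E i 1 l|) (by fun_prop) fun l => by
      rw [abs_abs]; linarith [hb l, abs_nonneg (E i 0 l + E i 1 l)]
    rw [← mul_add, ← integral_add i1 i2]
    have := integral_mono (i1.add i2) (integrable_const (2 : ℝ)) hb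
    simp only [integral_const, probReal_univ, one_smul, Pi.add_apply] at this
    linarith

/-! ### Violation of the `n`-locality inequality -/

theorem correlator_product_observables {n : ℕ} (τ : Fin n → TwoQubitOp)
    (A : Fin n → Fin 2 → BinaryPOVM (Fin 2)) (B : Fin 2 → BinaryPOVM (Fin n → Fin 2))
    (v : Fin n → Fin 2 → Fin 3 → ℝ) (M : Fin 2 → Fin n → QubitOp)
    (hA : ∀ i x, ∑ a : Fin 2, (-1 : ℂ) ^ (a : ℕ) • (A i x).effect a = sigma (v i x))
    (hB : ∀ y, ∑ b : Fin 2, (-1 : ℂ) ^ (b : ℕ) • (B y).effect b = tensorOp (M y))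
    (T : Fin n → Fin 2 → Fin 2 → ℝ)
    (hT : ∀ i x y, (τ i * (sigma (v i x) ⊗ₖ M y i)).trace = T i x y)
    (x : Fin n → Fin 2) (y : Fin 2) :
    correlator (bornBehavior τ A B) x y = ∏ i, T i (x i) y := by
  simp only [correlator_bornBehavior, hA, hB, trace_networkState_mul, hT]
  rw [← Complex.ofReal_prod, Complex.ofReal_re]

/-- The sum over x in I keeps only the e-part of each outer observable, and the signed sum in J only
the f-part. The cross correlations `T i 0 1` and `T i 1 0` therefore drop out and may be arbitrary
reals. -/
theorem isNetworkNonlocal_of_correlations {n : ℕ} (hn : 0 < n) (τ : Fin n → TwoQubitOp)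
    (e f b c : Fin n → Fin 3 → ℝ) (he : ∀ i, e i ⬝ᵥ e i = 1) (hf : ∀ i, f i ⬝ᵥ f i = 1)
    (hef : ∀ i, e i ⬝ᵥ f i = 0) (hb : ∀ i, b i ⬝ᵥ b i = 1) (hc : ∀ i, c i ⬝ᵥ c i = 1)
    (T : Fin n → Fin 2 → Fin 2 → ℝ)
    (h00 : ∀ i, (τ i * (sigma (e i) ⊗ₖ sigma (b i))).trace = T i 0 0)
    (h01 : ∀ i, (τ i * (sigma (e i) ⊗ₖ sigma (c i))).trace = T i 0 1)
    (h10 : ∀ i, (τ i * (sigma (f i) ⊗ₖ sigma (b i))).trace = T i 1 0)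
    (h11 : ∀ i, (τ i * (sigma (f i) ⊗ₖ sigma (c i))).trace = T i 1 1)
    {α β : ℝ} (hα : 0 ≤ α) (hβ : 0 ≤ β) (hαβ : 1 < α ^ 2 + β ^ 2)
    (hTα : ∀ i, α ≤ T i 0 0) (hTβ : ∀ i, β ≤ T i 1 1) :
    IsNetworkNonlocal τ := by
  have hn' : (n : ℝ) ≠ 0 := by exact_mod_cast hn.ne'
  set r := Real.sqrt (α ^ 2 + β ^ 2)
  have hrr : r ^ 2 = α ^ 2 + β ^ 2 := Real.sq_sqrt (by positivity)
  have hr1 : 1 < r := by rw [Real.lt_sqrt (by norm_num)]; simpa using hαβ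
  have hr0 : 0 < r := by linarith
  have hcs : (α / r) ^ 2 + (β / r) ^ 2 = 1 := by
    rw [div_pow, div_pow, ← add_div, ← hrr, div_self (by positivity)]
  set v : Fin n → Fin 2 → Fin 3 → ℝ :=
    fun i x => (α / r) • e i + ((-1) ^ (x : ℕ) * (β / r)) • f i with hv
  have hv1 (i x) : sigma (v i x) * sigma (v i x) = 1 := by
    have hfe : f i ⬝ᵥ e i = 0 := by rw [dotProduct_comm, hef]
    have h1 : ((-1 : ℝ) ^ (x : ℕ)) ^ 2 = 1 := by rw [← pow_mul, mul_comm, pow_mul]; simp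
    have : v i x ⬝ᵥ v i x = 1 := by
      simp only [hv, add_dotProduct, dotProduct_add, smul_dotProduct, dotProduct_smul, he, hf, hef,
        hfe, smul_eq_mul]
      linear_combination (β / r) ^ 2 * h1 + hcs
    rw [sigma_mul_self, this]
    simp
  set M : Fin 2 → Fin n → QubitOp := fun y i => if y = 0 then sigma (b i) else sigma (c i) with hM
  have hMH (y i) : (M y i)ᴴ = M y i := by
    simp only [hM]
    split_ifs <;> exact sigma_conjTranspose _
  have hM1 (y i) : M y i * M y i = 1 := by
    simp only [hM]
    split_ifs <;> simp [sigma_mul_self, hb, hc]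
  let A : Fin n → Fin 2 → BinaryPOVM (Fin 2) := fun i x =>
    .ofInvolution (sigma (v i x)) (sigma_conjTranspose _) (hv1 i x)
  let B : Fin 2 → BinaryPOVM (Fin n → Fin 2) := fun y =>
    .ofInvolution (tensorOp (M y)) (by simp [tensorOp_conjTranspose, hMH])
      (by simp [tensorOp_mul, hM1, tensorOp_one])
  have hcorr := correlator_product_observables τ A B v M
    (fun i x => BinaryPOVM.ofInvolution_signed_sum _ _ _)
    (fun y => BinaryPOVM.ofInvolution_signed_sum _ _ _)
    (fun i x y => (α / r) * T i 0 y + ((-1) ^ (x : ℕ) * (β / r)) * T i 1 y) (fun i x y => by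
      fin_cases y <;>
      simp [hv, hM, sigma_add, sigma_smul, Matrix.add_kronecker, Matrix.mul_add,
        Matrix.smul_kronecker, Matrix.trace_add, Matrix.trace_smul, h00, h01, h10, h11])
  have hI : corrI (bornBehavior τ A B) = ∏ i, ((α / r) * T i 0 0) := by
    rw [corrI]
    simp only [hcorr]
    rw [sum_pi_prod_eq fun i (x : Fin 2) => (α / r) * T i 0 0 + ((-1) ^ (x : ℕ) * (β / r)) * T i 1 0,
      half_pow_mul_prod]
    refine Finset.prod_congr rfl fun i _ => ?_
    simp only [Fin.sum_univ_two, Fin.val_zero, Fin.val_one]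
    ring
  have hJ : corrJ (bornBehavior τ A B) = ∏ i, ((β / r) * T i 1 1) := by
    rw [corrJ]
    simp only [hcorr, ← Finset.prod_pow_eq_pow_sum, ← Finset.prod_mul_distrib]
    rw [sum_pi_prod_eq fun i (x : Fin 2) => (-1) ^ (x : ℕ) *
      ((α / r) * T i 0 1 + ((-1) ^ (x : ℕ) * (β / r)) * T i 1 1), half_pow_mul_prod]
    refine Finset.prod_congr rfl fun i _ => ?_
    simp only [Fin.sum_univ_two, Fin.val_zero, Fin.val_one]
    ring
  have hroot (κ : ℝ) (hκ : 0 ≤ κ) (t : Fin n → ℝ) (ht : ∀ i, κ ≤ t i) :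
      κ / r * κ ≤ |∏ i, (κ / r * t i)| ^ (1 / n : ℝ) := by
    have h0 : 0 ≤ κ / r * κ := by positivity
    calc κ / r * κ = (∏ _i : Fin n, (κ / r * κ)) ^ (1 / n : ℝ) := by
          rw [Finset.prod_const, Finset.card_univ, Fintype.card_fin, one_div,
            Real.pow_rpow_inv_natCast h0 hn.ne']
      _ ≤ _ := by
          refine Real.rpow_le_rpow (Finset.prod_nonneg fun _ _ => h0)
            (le_trans ?_ (le_abs_self _)) (by positivity)
          exact Finset.prod_le_prod (fun _ _ => h0) fun i _ =>
            mul_le_mul_of_nonneg_left (ht i) (by positivity)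
  have hgt : 1 < nStar (bornBehavior τ A B) := by
    calc 1 < r := hr1
      _ = α / r * α + β / r * β := by field_simp; linarith
      _ ≤ _ := by
        rw [nStar, hI, hJ]
        exact add_le_add (hroot α hα _ hTα) (hroot β hβ _ hTβ)
  exact ⟨A, B, hgt, fun h => absurd (nStar_le_one_of_isNLocal hn h) (not_le.2 hgt)⟩

end StarNetwork

end

noncomputable section

namespace StarNetwork

/-! ### The correlation matrix and its singular values -/

theorem pauli_conjTranspose (i : Fin 3) : (pauli i)ᴴ = pauli i := by
  fin_cases i <;> ext a b <;> fin_cases a <;> fin_cases b <;> simp [pauli]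

theorem trace_mul_pauli {ρ : TwoQubitOp} (hρ : ρᴴ = ρ) (i j : Fin 3) :
    (ρ * (pauli i ⊗ₖ pauli j)).trace = (corrMatrix ρ i j : ℂ) := by
  have h : star (ρ * (pauli i ⊗ₖ pauli j)).trace = (ρ * (pauli i ⊗ₖ pauli j)).trace := by
    rw [← Matrix.trace_conjTranspose, Matrix.conjTranspose_mul, hρ, Matrix.conjTranspose_kronecker,
      pauli_conjTranspose, pauli_conjTranspose, Matrix.trace_mul_comm]
  exact (Complex.conj_eq_iff_re.1 h).symm

theorem trace_mul_sigma {ρ : TwoQubitOp} (hρ : ρᴴ = ρ) (v w : Fin 3 → ℝ) :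
    (ρ * (sigma v ⊗ₖ sigma w)).trace = ((v ⬝ᵥ corrMatrix ρ *ᵥ w : ℝ) : ℂ) := by
  simp only [sigma, sum_kronecker, kronecker_sum, Finset.mul_sum, Matrix.trace_sum,
    Matrix.smul_kronecker, Matrix.kronecker_smul, Matrix.mul_smul, Matrix.trace_smul,
    trace_mul_pauli hρ, smul_eq_mul, dotProduct, Matrix.mulVec]
  push_cast
  rw [Finset.sum_comm]
  refine Finset.sum_congr rfl fun i _ => Finset.sum_congr rfl fun j _ => ?_
  ring

theorem corrAbs_mul_self (ρ : TwoQubitOp) :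
    corrAbs ρ * corrAbs ρ = (corrMatrix ρ)ᵀ * corrMatrix ρ := by
  have h : 0 ≤ (corrMatrix ρ)ᴴ * corrMatrix ρ :=
    Matrix.nonneg_iff_posSemidef.mpr (posSemidef_conjTranspose_mul_self _)
  rw [corrAbs, CFC.sqrt_mul_sqrt_self _ h, conjTranspose_eq_transpose_of_trivial]

theorem exists_singular_basis (ρ : TwoQubitOp) :
    ∃ (d : Fin 3 → ℝ) (v : Fin 3 → Fin 3 → ℝ), d 0 = delta1 ρ ∧ d 1 = delta2 ρ ∧ Antitone d ∧
      (∀ i, 0 ≤ d i) ∧ (∀ i, v i ⬝ᵥ v i = 1) ∧ (∀ i j, i ≠ j → v i ⬝ᵥ v j = 0) ∧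
      (∀ i, ((corrMatrix ρ)ᵀ * corrMatrix ρ) *ᵥ v i = d i ^ 2 • v i) ∧
      ∏ i, d i ^ 2 = (corrMatrix ρ).det ^ 2 := by
  have hA := corrAbs_isHermitian ρ
  have hpos : (corrAbs ρ).PosSemidef := Matrix.nonneg_iff_posSemidef.mp (CFC.sqrt_nonneg _)
  -- `eigenvalues` is `eigenvalues₀` reindexed along an unspecified bijection; `κ` undoes it to
  -- recover the decreasing order.
  let κ : Fin 3 ≃ Fin 3 :=
    (finCongr (Fintype.card_fin 3).symm).trans (Fintype.equivOfCardEq (Fintype.card_fin _))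
  have hd (i : Fin 3) : hA.eigenvalues (κ i) = hA.eigenvalues₀ (Fin.cast (by simp) i) := by
    simp [Matrix.IsHermitian.eigenvalues, κ]
  have hin (i j : Fin 3) : (hA.eigenvectorBasis i).ofLp ⬝ᵥ (hA.eigenvectorBasis j).ofLp =
      if i = j then 1 else 0 := by
    have h := orthonormal_iff_ite.1 hA.eigenvectorBasis.orthonormal i j
    rw [EuclideanSpace.inner_eq_star_dotProduct, star_trivial, dotProduct_comm] at h
    exact h
  refine ⟨fun i => hA.eigenvalues (κ i), fun i => (hA.eigenvectorBasis (κ i)).ofLp, ?_, ?_, ?_,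
    fun i => hpos.eigenvalues_nonneg _, fun i => by simp [hin], fun i j hij => by simp [hin, hij],
    fun i => ?_, ?_⟩
  · simp only [hd]; rfl
  · simp only [hd]; rfl
  · intro i j hij
    simp only [hd]
    exact hA.eigenvalues₀_antitone hij
  · rw [← corrAbs_mul_self, ← Matrix.mulVec_mulVec, hA.mulVec_eigenvectorBasis, Matrix.mulVec_smul,
      hA.mulVec_eigenvectorBasis, smul_smul, pow_two]
  · rw [Equiv.prod_comp κ (fun i => hA.eigenvalues i ^ 2), Finset.prod_pow]
    have h : (corrAbs ρ).det = ∏ i, hA.eigenvalues i := hA.det_eq_prod_eigenvalues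
    have h2 := congrArg Matrix.det (corrAbs_mul_self ρ)
    rw [Matrix.det_mul, Matrix.det_mul, Matrix.det_transpose] at h2
    rw [← h, pow_two, pow_two, h2]

/-- Left singular vectors are the images t vᵢ / dᵢ of the right ones; this needs dᵢ ≠ 0. -/
theorem exists_isPrincipalPair {ρ : TwoQubitOp} (h1 : 0 < delta1 ρ) (h2 : 0 < delta2 ρ) :
    ∃ e f : Fin 3 → ℝ, IsPrincipalPair ρ e f := by
  obtain ⟨d, v, hd0, hd1, -, -, hv, hvv, heig, -⟩ := exists_singular_basis ρ
  rw [← hd0] at h1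
  rw [← hd1] at h2
  set t := corrMatrix ρ with ht
  have hin (i j : Fin 3) : (t *ᵥ v i) ⬝ᵥ (t *ᵥ v j) = d j ^ 2 * (v i ⬝ᵥ v j) := by
    rw [dotProduct_mulVec, vecMul_mulVec, ← dotProduct_mulVec, heig,
      dotProduct_smul, smul_eq_mul]
  have heig2 (i : Fin 3) (a : ℝ) : (t * tᵀ) *ᵥ (a • t *ᵥ v i) = d i ^ 2 • (a • t *ᵥ v i) := by
    rw [Matrix.mulVec_smul, ← Matrix.mulVec_mulVec, Matrix.mulVec_mulVec _ tᵀ, heig,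
      Matrix.mulVec_smul, smul_comm]
  refine ⟨(d 0)⁻¹ • t *ᵥ v 0, (d 1)⁻¹ • t *ᵥ v 1, ?_, ?_, ?_, ?_, ?_⟩
  · rw [smul_dotProduct, dotProduct_smul, hin, hv]
    simp only [smul_eq_mul]
    field_simp
  · rw [smul_dotProduct, dotProduct_smul, hin, hv]
    simp only [smul_eq_mul]
    field_simp
  · rw [smul_dotProduct, dotProduct_smul, hin, hvv 0 1 (by decide)]
    simp
  · rw [← hd0]; exact heig2 0 _
  · rw [← hd1]; exact heig2 1 _

/-! ### Pure states -/

/-- The squared concurrence of the vector `φ`. -/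
def concurrenceSq (φ : Fin 2 × Fin 2 → ℂ) : ℝ :=
  4 * Complex.normSq (φ (0, 0) * φ (1, 1) - φ (0, 1) * φ (1, 0))

theorem norm_eq_one_iff_re_im (φ : Fin 2 × Fin 2 → ℂ) : star φ ⬝ᵥ φ = 1 →
    (φ (0, 0)).re ^ 2 + (φ (0, 0)).im ^ 2 + (φ (0, 1)).re ^ 2 + (φ (0, 1)).im ^ 2 +
    (φ (1, 0)).re ^ 2 + (φ (1, 0)).im ^ 2 + (φ (1, 1)).re ^ 2 + (φ (1, 1)).im ^ 2 = 1 := by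
  intro h
  have := congrArg Complex.re h
  simp [dotProduct, Fintype.sum_prod_type] at this
  linarith

theorem corrMatrix_ketBra (φ : Fin 2 × Fin 2 → ℂ) (i j : Fin 3) :
    corrMatrix (ketBra φ) i j = (star φ ⬝ᵥ (pauli i ⊗ₖ pauli j) *ᵥ φ).re := by
  rw [corrMatrix, Matrix.of_apply, ketBra, Matrix.trace_mul_comm, Matrix.mul_vecMulVec,
    Matrix.trace_vecMulVec, dotProduct_comm]

theorem corrMatrix_ketBra_eq {φ : Fin 2 × Fin 2 → ℂ} {a b c d : ℂ} (ha : φ (0, 0) = a)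
    (hb : φ (0, 1) = b) (hc : φ (1, 0) = c) (hd : φ (1, 1) = d) :
    corrMatrix (ketBra φ) =
      !![2 * (a.re * d.re + a.im * d.im) + 2 * (b.re * c.re + b.im * c.im),
          2 * (a.re * d.im - a.im * d.re) - 2 * (b.re * c.im - b.im * c.re),
          2 * (a.re * c.re + a.im * c.im) - 2 * (b.re * d.re + b.im * d.im);
        2 * (a.re * d.im - a.im * d.re) + 2 * (b.re * c.im - b.im * c.re),
          2 * (b.re * c.re + b.im * c.im) - 2 * (a.re * d.re + a.im * d.im),
          2 * (a.re * c.im - a.im * c.re) - 2 * (b.re * d.im - b.im * d.re);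
        2 * (a.re * b.re + a.im * b.im) - 2 * (c.re * d.re + c.im * d.im),
          2 * (a.re * b.im - a.im * b.re) - 2 * (c.re * d.im - c.im * d.re),
          a.re ^ 2 + a.im ^ 2 - (b.re ^ 2 + b.im ^ 2) - (c.re ^ 2 + c.im ^ 2) +
            (d.re ^ 2 + d.im ^ 2)] := by
  subst ha hb hc hd
  rw [← Matrix.ext_iff]
  simp only [corrMatrix_ketBra, Fin.forall_fin_succ, pauli]
  simp [dotProduct, Matrix.mulVec, Fintype.sum_prod_type]
  refine ⟨⟨?_, ?_, ?_⟩, ⟨?_, ?_, ?_⟩, ?_, ?_, ?_⟩ <;> ring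

/-- The Gram matrix of the correlation matrix of a pure state is `C² + b bᵀ`, where `C` is the
concurrence and `b` is Bob's Bloch vector. -/
theorem exists_gram_corrMatrix_ketBra {φ : Fin 2 × Fin 2 → ℂ} (hφ : star φ ⬝ᵥ φ = 1) :
    ∃ β : Fin 3 → ℝ, β ⬝ᵥ β = 1 - concurrenceSq φ ∧
      (corrMatrix (ketBra φ))ᵀ * corrMatrix (ketBra φ) =
        concurrenceSq φ • (1 : Matrix (Fin 3) (Fin 3) ℝ) + vecMulVec β β := by
  have hN := norm_eq_one_iff_re_im φ hφ
  rw [corrMatrix_ketBra_eq rfl rfl rfl rfl, concurrenceSq]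
  generalize φ (0, 0) = a at *
  generalize φ (0, 1) = b at *
  generalize φ (1, 0) = c at *
  generalize φ (1, 1) = d at *
  obtain ⟨a1, a2⟩ := a
  obtain ⟨b1, b2⟩ := b
  obtain ⟨c1, c2⟩ := c
  obtain ⟨d1, d2⟩ := d
  simp only at hN ⊢
  refine ⟨![2 * (a1 * b1 + a2 * b2) + 2 * (c1 * d1 + c2 * d2),
    2 * (a1 * b2 - a2 * b1) + 2 * (c1 * d2 - c2 * d1),
    a1 ^ 2 + a2 ^ 2 - (b1 ^ 2 + b2 ^ 2) + (c1 ^ 2 + c2 ^ 2) - (d1 ^ 2 + d2 ^ 2)], ?_, ?_⟩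
  · simp [dotProduct, Fin.sum_univ_three, Complex.normSq_apply]
    -- With N = ‖φ‖², the identity is |β|² + C² = N², and N² − 1 = (N + 1)(N − 1).
    linear_combination (a1 ^ 2 + a2 ^ 2 + b1 ^ 2 + b2 ^ 2 + c1 ^ 2 + c2 ^ 2 + d1 ^ 2 + d2 ^ 2 + 1) *
      hN
  · ext i j
    rw [Matrix.add_apply, Matrix.vecMulVec_apply]
    fin_cases i <;> fin_cases j <;>
      simp [Matrix.mul_apply, Fin.sum_univ_three, Complex.normSq_apply] <;>
      ring

theorem det_corrMatrix_ketBra {φ : Fin 2 × Fin 2 → ℂ} (hφ : star φ ⬝ᵥ φ = 1) :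
    (corrMatrix (ketBra φ)).det = -concurrenceSq φ := by
  have hN := norm_eq_one_iff_re_im φ hφ
  -- Multiplying by ‖φ‖² = 1 raises the right side from degree 4 to 6, the degree of the
  -- determinant, giving a polynomial identity.
  rw [← mul_one (concurrenceSq φ), ← hN, corrMatrix_ketBra_eq rfl rfl rfl rfl, concurrenceSq,
    Matrix.det_fin_three]
  simp [Complex.normSq_apply]
  ring

/-- Zero concurrence says that the coefficient matrix of φ has determinant zero, hence rank one. The
state is then the product of its two marginals. -/
theorem isSeparable_ketBra {φ : Fin 2 × Fin 2 → ℂ} (hφ : star φ ⬝ᵥ φ = 1)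
    (h : concurrenceSq φ = 0) : IsSeparable (ketBra φ) := by
  have hdet : φ (0, 0) * φ (1, 1) = φ (0, 1) * φ (1, 0) := by
    rw [concurrenceSq, mul_eq_zero, Complex.normSq_eq_zero, sub_eq_zero] at h
    simpa using h
  have hdet' (i k l j : Fin 2) : φ (i, k) * φ (l, j) = φ (i, j) * φ (l, k) := by
    fin_cases i <;> fin_cases k <;> fin_cases l <;> fin_cases j <;> simp <;>
      first | ring1 | linear_combination hdet | linear_combination -hdet
  have hN : ∑ i, ∑ j, star (φ (i, j)) * φ (i, j) = 1 := by
    rw [← hφ, dotProduct, Fintype.sum_prod_type]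
    rfl
  let C : QubitOp := Matrix.of fun i j => φ (i, j)
  refine subset_convexHull ℝ _ ⟨C * Cᴴ, Cᵀ * (Cᵀ)ᴴ, ⟨posSemidef_self_mul_conjTranspose _, ?_⟩,
    ⟨posSemidef_self_mul_conjTranspose _, ?_⟩, ?_⟩
  · rw [← hN]
    simp only [Matrix.trace, Matrix.diag, Matrix.mul_apply, Matrix.conjTranspose_apply, C,
      Matrix.of_apply]
    exact Finset.sum_congr rfl fun i _ => Finset.sum_congr rfl fun j _ => mul_comm _ _
  · rw [← hN, Finset.sum_comm]
    simp only [Matrix.trace, Matrix.diag, Matrix.mul_apply, Matrix.conjTranspose_apply, C,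
      Matrix.of_apply, Matrix.transpose_apply]
    exact Finset.sum_congr rfl fun i _ => Finset.sum_congr rfl fun j _ => mul_comm _ _
  · ext ⟨i, j⟩ ⟨i', j'⟩
    have e (k l : Fin 2) : φ (i, k) * star (φ (i', k)) * (φ (l, j) * star (φ (l, j'))) =
        φ (i, j) * star (φ (i', j')) * (star (φ (l, k)) * φ (l, k)) := by
      have h1 := hdet' i k l j
      have h2 := congrArg star (hdet' i' k l j')
      rw [star_mul', star_mul'] at h2
      linear_combination star (φ (i', k)) * star (φ (l, j')) * h1 + φ (i, j) * φ (l, k) * h2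
    simp only [ketBra, Matrix.vecMulVec_apply, Pi.star_apply, Matrix.kroneckerMap_apply,
      Matrix.mul_apply, Matrix.conjTranspose_apply, Matrix.transpose_apply, C, Matrix.of_apply,
      Finset.sum_mul_sum, e, ← Finset.mul_sum]
    rw [Finset.sum_comm, hN, mul_one]

/-- Pairing the eigenvalue equation of C·1 + ββᵀ with β and with the eigenvector leaves only the
eigenvalues C and 1, where C > 0 is the squared concurrence. The determinant settles that 1 occurs.
-/
theorem delta_of_isPureState {ρ : TwoQubitOp} (hent : IsEntangled ρ) (h : IsPureState ρ) :
    delta1 ρ = 1 ∧ 0 < delta2 ρ := by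
  obtain ⟨φ, hφ, rfl⟩ := h
  have hC0 : 0 < concurrenceSq φ :=
    lt_of_le_of_ne (mul_nonneg (by norm_num) (Complex.normSq_nonneg _))
      fun h => hent (isSeparable_ketBra hφ h.symm)
  obtain ⟨β, hβ, hgram⟩ := exists_gram_corrMatrix_ketBra hφ
  obtain ⟨d, v, hd0, hd1, hanti, hpos, hv, -, heig, hdet⟩ := exists_singular_basis (ketBra φ)
  rw [det_corrMatrix_ketBra hφ, hgram, neg_sq] at *
  set C := concurrenceSq φ
  have hC1 : C ≤ 1 := by
    have : 0 ≤ β ⬝ᵥ β := Finset.sum_nonneg fun i _ => mul_self_nonneg _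
    linarith
  have key (i : Fin 3) : d i ^ 2 = C ∨ d i ^ 2 = 1 := by
    have h := heig i
    rw [add_mulVec, smul_mulVec, one_mulVec, vecMulVec_mulVec] at h
    have h1 := congrArg (fun z => β ⬝ᵥ z) h
    have h2 := congrArg (fun z => v i ⬝ᵥ z) h
    simp only [dotProduct_add, dotProduct_smul, hβ, hv, smul_eq_mul, MulOpposite.smul_eq_mul_unop,
      MulOpposite.unop_op] at h1 h2
    by_cases h0 : β ⬝ᵥ v i = 0
    · left
      rw [h0] at h2
      linarith
    · right
      apply mul_right_cancel₀ h0
      linarith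
  -- Otherwise all three eigenvalues are C, and comparing determinants gives C³ = C², so C = 1 after
  -- all.
  have hd0' : d 0 ^ 2 = 1 := by
    by_contra hne
    have hall (i : Fin 3) : d i ^ 2 = C := by
      refine (key i).resolve_right fun hi => hne ?_
      have h0 : d i ≤ d 0 := hanti (Fin.zero_le i)
      have := pow_le_pow_left₀ (hpos i) h0 2
      rcases key 0 with h | h <;> linarith
    simp only [hall, Fin.prod_univ_three] at hdet
    have : C = 1 := mul_right_cancel₀ (pow_ne_zero 2 hC0.ne') (by linarith)
    exact hne (by rw [hall, this])
  constructor
  · rw [← hd0]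
    nlinarith [hpos 0]
  · rw [← hd1]
    refine lt_of_le_of_ne (hpos 1) fun h => ?_
    have := key 1
    rw [← h] at this
    rcases this with h | h <;> norm_num at h
    exact hC0.ne h

end StarNetwork

end

noncomputable section

namespace StarNetwork

/-! ### Correlations along the sequence of measurements -/

/-- The factor by which one round of measurement reduces the correlations along `e`. -/
def principalFactor (θ γ : ℝ) : ℝ :=
  contraction θ γ + Real.cos θ ^ 2 / (1 + contraction θ γ)

/-- The factor by which one round of measurement reduces the correlations along `f`. -/
def secondaryFactor (θ γ : ℝ) : ℝ :=
  contraction θ γ + γ ^ 2 * Real.sin θ ^ 2 / (1 + contraction θ γ)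

theorem contraction_nonneg {θ : ℝ} (hθ : 0 ≤ Real.sin θ) (γ : ℝ) : 0 ≤ contraction θ γ :=
  mul_nonneg hθ (Real.sqrt_nonneg _)

theorem one_sub_contraction_sq {θ γ : ℝ} (hγ : γ ^ 2 ≤ 1) :
    1 - contraction θ γ ^ 2 = Real.cos θ ^ 2 + γ ^ 2 * Real.sin θ ^ 2 := by
  rw [contraction, mul_pow, Real.sq_sqrt (by linarith)]
  linear_combination -Real.sin_sq_add_cos_sq θ

theorem principalFactor_nonneg {θ : ℝ} (hθ : 0 ≤ Real.sin θ) (γ : ℝ) : 0 ≤ principalFactor θ γ := by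
  have := contraction_nonneg hθ γ
  rw [principalFactor]
  positivity

theorem secondaryFactor_nonneg {θ : ℝ} (hθ : 0 ≤ Real.sin θ) (γ : ℝ) :
    0 ≤ secondaryFactor θ γ := by
  have := contraction_nonneg hθ γ
  rw [secondaryFactor]
  positivity

theorem principalFactor_le_one {θ γ : ℝ} (hθ : 0 ≤ Real.sin θ) (hγ : γ ^ 2 ≤ 1) :
    principalFactor θ γ ≤ 1 := by
  have h := contraction_nonneg hθ γ
  have h2 := one_sub_contraction_sq (θ := θ) hγ
  have h3 : 0 ≤ γ ^ 2 * Real.sin θ ^ 2 := by positivity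
  rw [principalFactor, ← le_sub_iff_add_le', div_le_iff₀ (by linarith)]
  linarith

theorem secondaryFactor_le_one {θ γ : ℝ} (hθ : 0 ≤ Real.sin θ) (hγ : γ ^ 2 ≤ 1) :
    secondaryFactor θ γ ≤ 1 := by
  have h := contraction_nonneg hθ γ
  have h2 := one_sub_contraction_sq (θ := θ) hγ
  have h3 : 0 ≤ Real.cos θ ^ 2 := by positivity
  rw [secondaryFactor, ← le_sub_iff_add_le', div_le_iff₀ (by linarith)]
  linarith

/-- The strict inequality already holds at γ = 0, where the left factor is 1 and the right term is
(sinᴷθ · δ)² > 0. Continuity carries it to small positive γ. -/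
theorem exists_sharpness {θ δ : ℝ} (hθ : 0 < Real.sin θ) (hδ : 0 < δ) (K : ℕ) :
    ∃ γ ∈ Set.Ioo (0 : ℝ) 1,
      1 < (principalFactor θ γ ^ K) ^ 2 + (secondaryFactor θ γ ^ K * δ) ^ 2 := by
  have hne (γ : ℝ) : 1 + contraction θ γ ≠ 0 := by
    have := contraction_nonneg hθ.le γ
    positivity
  have hs : Continuous fun γ => contraction θ γ := by unfold contraction; fun_prop
  have hcont : Continuous fun γ =>
      (principalFactor θ γ ^ K) ^ 2 + (secondaryFactor θ γ ^ K * δ) ^ 2 := by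
    unfold principalFactor secondaryFactor
    fun_prop (disch := exact hne)
  have hs0 : contraction θ 0 = Real.sin θ := by simp [contraction]
  have h0 : 1 < (principalFactor θ 0 ^ K) ^ 2 + (secondaryFactor θ 0 ^ K * δ) ^ 2 := by
    have e1 : principalFactor θ 0 = 1 := by
      rw [principalFactor, hs0, Real.cos_sq']
      field_simp
      ring
    have e2 : secondaryFactor θ 0 = Real.sin θ := by simp [secondaryFactor, hs0]
    rw [e1, e2]
    have : 0 < (Real.sin θ ^ K * δ) ^ 2 := by positivity
    simpa using this
  have h1 : ∀ᶠ γ in nhdsWithin (0 : ℝ) (Set.Ioi 0),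
      1 < (principalFactor θ γ ^ K) ^ 2 + (secondaryFactor θ γ ^ K * δ) ^ 2 :=
    (hcont.continuousAt.eventually (lt_mem_nhds h0)).filter_mono nhdsWithin_le_nhds
  obtain ⟨γ, hγ, hγ'⟩ := (h1.and (Ioo_mem_nhdsGT one_pos)).exists
  exact ⟨γ, hγ', hγ⟩

theorem trace_seqState {e f : Fin 3 → ℝ} (he : e ⬝ᵥ e = 1) (hf : f ⬝ᵥ f = 1)
    (hef : e ⬝ᵥ f = 0) {θ γ : ℝ} (hθ : 0 ≤ Real.sin θ) (hγ : γ ^ 2 ≤ 1)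
    (ρ : TwoQubitOp) (N : QubitOp) (k : ℕ) :
    (seqState e f θ (fun _ => γ) ρ (k + 1) * (sigma e ⊗ₖ N)).trace =
        (principalFactor θ γ ^ k : ℝ) * (ρ * (sigma e ⊗ₖ N)).trace ∧
      (seqState e f θ (fun _ => γ) ρ (k + 1) * (sigma f ⊗ₖ N)).trace =
        (secondaryFactor θ γ ^ k : ℝ) * (ρ * (sigma f ⊗ₖ N)).trace := by
  have hfe : f ⬝ᵥ e = 0 := by rw [dotProduct_comm, hef]
  induction k with
  | zero => simp [seqState]
  | succ k ih =>
    rw [seqState, trace_measureStep he hf hef hθ hγ, trace_measureStep he hf hef hθ hγ]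
    simp only [he, hf, hef, hfe, mul_one, mul_zero, zero_div, zero_smul, add_zero, ← add_smul]
    rw [← principalFactor, ← secondaryFactor, sigma_smul, sigma_smul, Matrix.smul_kronecker,
      Matrix.smul_kronecker, Matrix.mul_smul, Matrix.mul_smul, Matrix.trace_smul, Matrix.trace_smul,
      ih.1, ih.2, pow_succ, pow_succ]
    push_cast
    constructor <;> simp only [smul_eq_mul] <;> ring

/-- `τ` has correlations at least `α` and `β` along two pairs of orthogonal directions on Alice's
side, with vanishing cross correlations. -/
def HasCorrelations (τ : TwoQubitOp) (α β : ℝ) : Prop :=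
  ∃ (e f b c : Fin 3 → ℝ) (S T : ℝ), e ⬝ᵥ e = 1 ∧ f ⬝ᵥ f = 1 ∧ e ⬝ᵥ f = 0 ∧ b ⬝ᵥ b = 1 ∧
    c ⬝ᵥ c = 1 ∧ (τ * (sigma e ⊗ₖ sigma b)).trace = S ∧ (τ * (sigma e ⊗ₖ sigma c)).trace = 0 ∧
    (τ * (sigma f ⊗ₖ sigma b)).trace = 0 ∧ (τ * (sigma f ⊗ₖ sigma c)).trace = T ∧ α ≤ S ∧ β ≤ T

theorem isNetworkNonlocal_of_hasCorrelations {n : ℕ} (hn : 0 < n) {τ : Fin n → TwoQubitOp}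
    {α β : ℝ} (hα : 0 ≤ α) (hβ : 0 ≤ β) (hαβ : 1 < α ^ 2 + β ^ 2)
    (hτ : ∀ i, HasCorrelations (τ i) α β) : IsNetworkNonlocal τ := by
  choose e f b c S T he hf hef hb hc h00 h01 h10 h11 hS hT using hτ
  refine isNetworkNonlocal_of_correlations hn τ e f b c he hf hef hb hc
    (fun i => !![S i, 0; 0, T i]) ?_ ?_ ?_ ?_ hα hβ hαβ ?_ ?_ <;>
  simpa

theorem hasCorrelations_psi {α β : ℝ} (hα : α ≤ 1) (hβ : β ≤ 1) :
    HasCorrelations (ketBra psi) α β := by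
  have hH : (ketBra psi)ᴴ = ketBra psi := by simp [ketBra, conjTranspose_vecMulVec]
  have h2 : √2 / 2 * (√2 / 2) = 1 / 2 := by
    rw [div_mul_div_comm, Real.mul_self_sqrt (by norm_num)]
    norm_num
  have ht : corrMatrix (ketBra psi) = !![1, 0, 0; 0, -1, 0; 0, 0, 1] := by
    rw [corrMatrix_ketBra_eq rfl rfl rfl rfl]
    simp [psi, pow_two, h2]
    norm_num
  refine ⟨![0, 0, 1], ![1, 0, 0], ![0, 0, 1], ![1, 0, 0], 1, 1, ?_, ?_, ?_, ?_, ?_, ?_, ?_, ?_, ?_,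
    hα, hβ⟩
  any_goals simp [dotProduct, Fin.sum_univ_three]; done
  all_goals
    rw [trace_mul_sigma hH, ht]
    simp [dotProduct, Matrix.mulVec, Fin.sum_univ_three]

theorem hasCorrelations_seqState {ρ : TwoQubitOp} (hρ : ρᴴ = ρ) {e f : Fin 3 → ℝ}
    (hp : IsPrincipalPair ρ e f) (h1 : delta1 ρ = 1) (h2 : 0 < delta2 ρ) {θ γ : ℝ}
    (hθ : 0 ≤ Real.sin θ) (hγ : γ ^ 2 ≤ 1) {k K : ℕ} (hk : k ≤ K) :
    HasCorrelations (seqState e f θ (fun _ => γ) ρ (k + 1)) (principalFactor θ γ ^ K)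
      (secondaryFactor θ γ ^ K * delta2 ρ) := by
  obtain ⟨he, hf, hef, hte, htf⟩ := hp
  have hfe : f ⬝ᵥ e = 0 := by rw [dotProduct_comm, hef]
  set t := corrMatrix ρ with ht
  have hbb (v w : Fin 3 → ℝ) : (tᵀ *ᵥ v) ⬝ᵥ (tᵀ *ᵥ w) = v ⬝ᵥ ((t * tᵀ) *ᵥ w) := by
    rw [dotProduct_mulVec, vecMul_mulVec, ← dotProduct_mulVec, transpose_transpose]
  have hseq (N : QubitOp) := trace_seqState he hf hef hθ hγ ρ N k
  -- Bob's directions are the matching right singular vectors; the first needs no normalization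
  -- because δ₁ = 1.
  refine ⟨e, f, tᵀ *ᵥ e, (delta2 ρ)⁻¹ • tᵀ *ᵥ f, principalFactor θ γ ^ k,
    secondaryFactor θ γ ^ k * delta2 ρ, he, hf, hef, ?_, ?_, ?_, ?_, ?_, ?_, ?_, ?_⟩
  · rw [hbb, hte, h1, dotProduct_smul, he]
    simp
  · rw [smul_dotProduct, dotProduct_smul, hbb, htf, dotProduct_smul, hf]
    simp only [smul_eq_mul]
    field_simp
  · rw [(hseq _).1, trace_mul_sigma hρ, Matrix.mulVec_mulVec, hte, h1, dotProduct_smul, he]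
    simp
  · rw [(hseq _).1, trace_mul_sigma hρ, Matrix.mulVec_smul, Matrix.mulVec_mulVec, htf,
      dotProduct_smul, dotProduct_smul, hef]
    simp
  · rw [(hseq _).2, trace_mul_sigma hρ, Matrix.mulVec_mulVec, hte, dotProduct_smul, hfe]
    simp
  · rw [(hseq _).2, trace_mul_sigma hρ, Matrix.mulVec_smul, Matrix.mulVec_mulVec, htf,
      dotProduct_smul, dotProduct_smul, hf]
    simp only [smul_eq_mul, ← Complex.ofReal_mul]
    congr 2
    field_simp
  · exact pow_le_pow_of_le_one (principalFactor_nonneg hθ γ) (principalFactor_le_one hθ hγ) hk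
  · exact mul_le_mul_of_nonneg_right
      (pow_le_pow_of_le_one (secondaryFactor_nonneg hθ γ) (secondaryFactor_le_one hθ hγ) hk) h2.le

theorem delta2_le_delta1 (ρ : TwoQubitOp) : delta2 ρ ≤ delta1 ρ :=
  (corrAbs_isHermitian ρ).eigenvalues₀_antitone (by simp)

end StarNetwork

end

/-! ### The main theorem. -/

theorem theorem6 (n p : ℕ) (hp : 2 ≤ p) (hpn : p ≤ n)
    (ρ : StarNetwork.TwoQubitOp) (hρ : StarNetwork.IsState ρ)
    (hent : StarNetwork.IsEntangled ρ)
    (h : StarNetwork.IsPureState ρ ∨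
      (StarNetwork.delta1 ρ = 1 ∧ 0 < StarNetwork.delta2 ρ)) :
    (∃ e f : Fin 3 → ℝ, StarNetwork.IsPrincipalPair ρ e f) ∧
    ∀ e f : Fin 3 → ℝ, StarNetwork.IsPrincipalPair ρ e f →
      ∀ θ ∈ Set.Ioc (0 : ℝ) (Real.pi / 4), ∀ m : Fin p → ℕ,
        ∃ γ : ℕ → ℝ, (∀ k, γ k ∈ Set.Ioo (0 : ℝ) 1) ∧
          ∀ k : Fin p → ℕ, (∀ i, 1 ≤ k i ∧ k i ≤ m i) →
            StarNetwork.IsNetworkNonlocal (fun i : Fin n =>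
              if hi : (i : ℕ) < p then StarNetwork.seqState e f θ γ ρ (k ⟨i, hi⟩)
              else StarNetwork.ketBra StarNetwork.psi) := by
  obtain ⟨h1, h2⟩ : StarNetwork.delta1 ρ = 1 ∧ 0 < StarNetwork.delta2 ρ :=
    h.elim (StarNetwork.delta_of_isPureState hent) id
  refine ⟨StarNetwork.exists_isPrincipalPair (h1 ▸ one_pos) h2, fun e f hef θ hθ m => ?_⟩
  have hsin : 0 < Real.sin θ :=
    Real.sin_pos_of_pos_of_lt_pi hθ.1 (by linarith [hθ.2, Real.pi_pos])
  -- The sum of the `m i` is a convenient upper bound for the number of rounds at any node.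
  obtain ⟨γ, hγ, hviol⟩ := StarNetwork.exists_sharpness hsin h2 (∑ i, m i)
  have hγ2 : γ ^ 2 ≤ 1 := pow_le_one₀ hγ.1.le hγ.2.le
  have hP := StarNetwork.principalFactor_nonneg hsin.le γ
  have hS := StarNetwork.secondaryFactor_nonneg hsin.le γ
  refine ⟨fun _ => γ, fun _ => hγ, fun k hk =>
    StarNetwork.isNetworkNonlocal_of_hasCorrelations (by omega) (pow_nonneg hP _)
      (mul_nonneg (pow_nonneg hS _) h2.le) hviol fun i => ?_⟩
  split_ifs with hi
  -- The state with index j + 1 has undergone j rounds.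
  · obtain ⟨j, hj⟩ : ∃ j, k ⟨i, hi⟩ = j + 1 := Nat.exists_eq_add_of_le' (hk _).1
    have hle : m ⟨i, hi⟩ ≤ ∑ i, m i :=
      Finset.single_le_sum (fun _ _ => Nat.zero_le _) (Finset.mem_univ _)
    have hkm := (hk ⟨i, hi⟩).2
    rw [hj] at hkm ⊢
    exact StarNetwork.hasCorrelations_seqState hρ.1.isHermitian hef h1 h2 hsin.le hγ2 (by omega)
  · exact StarNetwork.hasCorrelations_psi
      (pow_le_one₀ hP (StarNetwork.principalFactor_le_one hsin.le hγ2))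
      (mul_le_one₀ (pow_le_one₀ hS (StarNetwork.secondaryFactor_le_one hsin.le hγ2)) h2.le
        (h1 ▸ StarNetwork.delta2_le_delta1 ρ))
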